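/- **Setting.** Let $S\ge 1$ be the number of time stamps of a day, $M$ the number of base stations and $H$ the number of historical days. The data of one day form a finite multiset of user trajectories $\{1,\dots,S\}\to\{1,\dots,M\}$; two days' data are neighbouring if one is obtained from the other by removing one trajectory. The histogram $D_i\in\mathbb R^M$ of a day counts the users at each base station at time $i$. A database consists of the data of the $H$ historical days and of the current day. The data of different days are treated as independent (disjoint) records: two databases are neighbouring if they agree on all days except one (historical or current), on which their data are neighbouring. A mechanism satisfies $\epsilon$-DP if $\Pr[\mathcal M(B)\in O]\le e^{\epsilon}\Pr[\mathcal M(B')\in O]$ for all neighbouring $B,B'$ and all events $O$. $\mathrm{Lap}(b)$ is the distribution with density $\frac1{2b}e^{-|x|/b}$; noise on a histogram is i.i.d. in its entries; all random draws are independent. **Utility.** Fix $\alpha>1$. For $1\le i\le j\le S$ put $n=j-i+1$, $L_t=\|D_t-D_{t+1}\|_1$, $$\mathrm{ave}=\tfrac1n\sum_{t=i}^{j-1}L_t,\qquad \mathrm{var}=\tfrac1n\sum_{t=i}^{j-1}|\mathrm{ave}-L_t|,\qquad U(i,j)=\log_\alpha(n)\cdot\frac{\mathrm{ave}}{\mathrm{simVar}},$$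 where $\mathrm{simVar}=1$ if $i=j$ or $\mathrm{var}<1$, and $\mathrm{simVar}=\mathrm{var}$ otherwise. The sensitivity of $U$ is the supremum of $|U(i,j)-U'(i,j)|$ over all $i\le j$ and all pairs of neighbouring days' data (it is finite). Let $\Delta$ be at least this sensitivity. **Direct perturbation** of $n$ histograms with budget $\epsilon'$: add $\mathrm{Lap}(n/\epsilon')$ noise to each of them. **Threshold perturbation** of $D_1,\dots,D_n$ with budget $\epsilon'$ and cutoff $c\ge1$ (for a fixed threshold $T\in\mathbb R$ and a fixed $a\in(0,1)$): put $\epsilon_1=a\epsilon'$, $\epsilon_2=(1-a)\epsilon'$. If $n=0$, return nothing. Otherwise release $\widetilde D_1=D_1+\mathrm{Lap}(2c/\epsilon_2)$, draw $\widetilde T_1=T+\mathrm{Lap}(2c/\epsilon_1)$ and set $cnt=1$. For $i=2,\dots,n$: (i) if $cnt\ge c$, release $\widetilde D_i=\widetilde D_{i-1}$; (ii) otherwise, if $i=n$, release $\widetilde D_n=D_n+\mathrm{Lap}(2/\epsilon_l)$, where $\epsilon_l=\epsilon'(c-cnt)/c$ is the budget left; (iii) otherwise draw $\widetilde d_i=\|\widetilde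 D_{i-1}-D_i\|_1+\mathrm{Lap}(4c/\epsilon_1)$; if $\widetilde d_i\ge\widetilde T_{cnt}$, release $\widetilde D_i=D_i+\mathrm{Lap}(2c/\epsilon_2)$, increase $cnt$ by one and draw a new $\widetilde T_{cnt}=T+\mathrm{Lap}(2c/\epsilon_1)$; if not, release $\widetilde D_i=\widetilde D_{i-1}$. **Dynamic hybrid perturbation.** Let $\epsilon=\epsilon_{t1}+\epsilon_d+\epsilon_{t2}$ with $\epsilon_{t1},\epsilon_d,\epsilon_{t2}>0$, and let $c_1,c_2\ge1$ be integers. 1. For each historical day $h$, independently, select division points $(t_1^h,t_2^h)$, $t_1^h\le t_2^h$, with probability proportional to $\exp(\epsilon\,U_h(i,j)/(2\Delta))$ (uniformly if $\Delta=0$). 2. For $k=1,2$, train a linear model $\theta_0+\theta_1x$ on the targets $(t_k^h)_{h\le H}$ by the gradient iterations $\theta:=\theta+\beta\,(t_k^{h}-\theta_0-\theta_1x_{k,h})(1,x_{k,h})$, with arbitrary data-independent features, learning rate, initial value and finite sequence of samples $h$. Evaluate it at the feature of the current day and round the value to the nearest time stamp in $\{1,\dots,S\}$; this gives $\hat t_1$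 and $\hat t_2$, where $\hat t_2$ is replaced by $\max(\hat t_1,\hat t_2)$. 3. On the current day's histograms, run threshold perturbation with $(\epsilon_{t1},c_1)$ on the times $[1,\hat t_1-1]$, direct perturbation with $\epsilon_d$ on $[\hat t_1,\hat t_2]$ and threshold perturbation with $(\epsilon_{t2},c_2)$ on $[\hat t_2+1,S]$, with independent noise. Return the resulting $S$ noisy histograms. **Theorem.** For all these parameters, the dynamic hybrid perturbation mechanism is a well-defined randomized mechanism (its output has a probability law for every database) and satisfies $\epsilon$-differential privacy. -/

import Mathlib

open MeasureTheory
open scoped ENNReal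

namespace MobilityDP

noncomputable section

/-! ### Differential privacy -/

/-- A randomized mechanism, given by its output law on every database, is `ε`-differentially
private for the neighbouring relation `adj`. -/
def IsDP {𝒟 Ω : Type*} [MeasurableSpace Ω] (adj : 𝒟 → 𝒟 → Prop) (mech : 𝒟 → Measure Ω)
    (ε : ℝ) : Prop :=
  (∀ D, IsProbabilityMeasure (mech D)) ∧
    ∀ D D', adj D D' → ∀ O : Set Ω, MeasurableSet O →
      mech D O ≤ ENNReal.ofReal (Real.exp ε) * mech D' O

/-- The Laplace distribution with scale `b`, by its density `exp (-|x| / b) / (2 b)`. -/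
def laplace (b : ℝ) : Measure ℝ :=
  volume.withDensity fun x => ENNReal.ofReal (1 / (2 * b) * Real.exp (-|x| / b))

/-! ### Mobility data -/

/-- The trajectory of one user during a day: the base station at each of the `S` time stamps. -/
abbrev Trajectory (S M : ℕ) : Type := Fin S → Fin M

/-- The mobility data of one day: a finite family of user trajectories, one for each user. -/
abbrev Day (S M : ℕ) : Type := Multiset (Trajectory S M)

/-- A (possibly noisy) histogram over the `M` base stations. -/
abbrev Hist (M : ℕ) : Type := Fin M → ℝ

/-- The aggregated mobility dataset of a day: entry `i m` is the number of users who are at base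
station `m` at time stamp `i`. -/
def aggregate {S M : ℕ} (D : Day S M) : Fin S → Hist M :=
  fun i m => (D.countP (fun τ => τ i = m) : ℝ)

/-- Two days' data are neighbouring if one of them is the other with one trajectory removed. -/
def DayAdj {S M : ℕ} (D D' : Day S M) : Prop :=
  ∃ τ : Trajectory S M, D = τ ::ₘ D' ∨ D' = τ ::ₘ D

/-- The data of `H` historical days together with the data of the current day. -/
structure Database (S M H : ℕ) where
  past : Fin H → Day S M
  current : Day S M

/-- Neighbouring databases: the data of different days are separate records, and the databases
differ by one trajectory of a single (historical or current) day. -/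
def DatabaseAdj {S M H : ℕ} (B B' : Database S M H) : Prop :=
  (∃ h : Fin H, DayAdj (B.past h) (B'.past h) ∧ (∀ k, k ≠ h → B.past k = B'.past k) ∧
      B.current = B'.current) ∨
    (B.past = B'.past ∧ DayAdj B.current B'.current)

/-- The `L₁` distance of two histograms. -/
def l1Dist {M : ℕ} (x y : Hist M) : ℝ := ∑ m, |x m - y m|

/-! ### Direct perturbation -/

/-- Add independent Laplace noise of scale `b` to every entry of a histogram. -/
def perturb {M : ℕ} (b : ℝ) (x : Hist M) : Measure (Hist M) :=
  (Measure.pi fun _ : Fin M => laplace b).map fun z => x + z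

/-- Direct perturbation of `n` histograms with budget `ε` and histogram sensitivity `ΔH`. -/
def directPerturbation {n M : ℕ} (ΔH ε : ℝ) (D : Fin n → Hist M) : Measure (Fin n → Hist M) :=
  Measure.pi fun i => perturb (n * ΔH / ε) (D i)

/-! ### Threshold perturbation -/

/-- The loop of threshold perturbation, run on the `k` histograms that are still to be published.
`prev` is the last published histogram, `cnt` the number of perturbations so far, and `thr` the
noisy threshold in force. Each of the `cnt` perturbations so far has used up the share
`(ε₁ + ε₂) / c` of the budget `ε₁ + ε₂`, so that `(ε₁ + ε₂) (c - cnt) / c` is left for the last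
histogram. -/
def thresholdLoop {M : ℕ} (ε₁ ε₂ T ΔD : ℝ) (c : ℕ) :
    (k : ℕ) → (Fin k → Hist M) → (prev : Hist M) → (cnt : ℕ) → (thr : ℝ) →
      Measure (Fin k → Hist M)
  | 0, _, _, _, _ => Measure.dirac Fin.elim0
  | k + 1, D, prev, cnt, thr =>
    if c ≤ cnt then
      (thresholdLoop ε₁ ε₂ T ΔD c k (Fin.tail D) prev cnt thr).map
        fun out => (Fin.cons prev out : Fin (k + 1) → Hist M)
    else if k = 0 then
      (perturb (ΔD / ((ε₁ + ε₂) * (c - cnt) / c)) (D 0)).map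
        fun x => (fun _ => x : Fin (k + 1) → Hist M)
    else
      (laplace (2 * c * ΔD / ε₁)).bind fun ν =>
        if thr ≤ l1Dist prev (D 0) + ν then
          (perturb (c * ΔD / ε₂) (D 0)).bind fun x =>
            (laplace (c * ΔD / ε₁)).bind fun ρ =>
              (thresholdLoop ε₁ ε₂ T ΔD c k (Fin.tail D) x (cnt + 1) (T + ρ)).map
                fun out => (Fin.cons x out : Fin (k + 1) → Hist M)
        else
          (thresholdLoop ε₁ ε₂ T ΔD c k (Fin.tail D) prev cnt thr).map
            fun out => (Fin.cons prev out : Fin (k + 1) → Hist M)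

/-- Threshold perturbation of `n` histograms with budget `ε`, threshold `T`, distance sensitivity
`ΔD` and cutoff point `c`; the fraction `a` of the budget is used for the comparisons. -/
def thresholdPerturbation {M : ℕ} (a T ΔD ε : ℝ) (c : ℕ) :
    (n : ℕ) → (Fin n → Hist M) → Measure (Fin n → Hist M)
  | 0, _ => Measure.dirac Fin.elim0
  | n + 1, D =>
    (perturb (c * ΔD / ((1 - a) * ε)) (D 0)).bind fun x =>
      (laplace (c * ΔD / (a * ε))).bind fun ρ =>
        (thresholdLoop (a * ε) ((1 - a) * ε) T ΔD c n (Fin.tail D) x 1 (T + ρ)).map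
          fun out => (Fin.cons x out : Fin (n + 1) → Hist M)

/-! ### Private time division -/

/-- The possible pairs of division points `i ≤ j`. -/
abbrev Division (S : ℕ) : Type := {p : Fin S × Fin S // p.1 ≤ p.2}

/-- The `L₁` distance of the histograms at the time stamps `t` and `t + 1`. -/
def stepDist {S M : ℕ} (D : Fin S → Hist M) (t : ℕ) : ℝ :=
  if h : t + 1 < S then l1Dist (D ⟨t, by omega⟩) (D ⟨t + 1, h⟩) else 0

/-- The length `j - i + 1` of the period from `i` to `j`. -/
def Division.len {S : ℕ} (p : Division S) : ℝ := (p.1.2 : ℕ) - (p.1.1 : ℕ) + 1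

def aveDis {S M : ℕ} (D : Fin S → Hist M) (p : Division S) : ℝ :=
  1 / p.len * ∑ t ∈ Finset.Ico (p.1.1 : ℕ) p.1.2, stepDist D t

def rawVar {S M : ℕ} (D : Fin S → Hist M) (p : Division S) : ℝ :=
  1 / p.len * ∑ t ∈ Finset.Ico (p.1.1 : ℕ) p.1.2, |aveDis D p - stepDist D t|

/-- The mean absolute deviation of the distances, replaced by `1` if `i = j` or if it is below
`1`. -/
def simVar {S M : ℕ} (D : Fin S → Hist M) (p : Division S) : ℝ :=
  if p.1.1 = p.1.2 ∨ rawVar D p < 1 then 1 else rawVar D p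

/-- The utility of a pair of division points. -/
def utility {S M : ℕ} (α : ℝ) (D : Fin S → Hist M) (p : Division S) : ℝ :=
  Real.logb α p.len * (aveDis D p / simVar D p)

/-- The changes of the utility of a pair of division points between neighbouring days' data. -/
def utilityGaps (S M : ℕ) (α : ℝ) : Set ℝ :=
  {g | ∃ (p : Division S) (D D' : Day S M), DayAdj D D' ∧
    g = |utility α (aggregate D) p - utility α (aggregate D') p|}

/-- The global sensitivity of the utility function. -/
def utilitySensitivity (S M : ℕ) (α : ℝ) : ℝ := sSup (utilityGaps S M α)

lemma one_le_len {S : ℕ} (p : Division S) : 1 ≤ p.len := by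
  have h : ((p.1.1 : ℕ) : ℝ) ≤ (p.1.2 : ℕ) := by exact_mod_cast p.2
  unfold Division.len; linarith

lemma len_le {S : ℕ} (p : Division S) : p.len ≤ S := by
  have h : ((p.1.2 : ℕ) : ℝ) + 1 ≤ S := by exact_mod_cast p.1.2.2
  have h' : (0 : ℝ) ≤ (p.1.1 : ℕ) := by positivity
  unfold Division.len; linarith

lemma stepDist_nonneg {S M : ℕ} (D : Fin S → Hist M) (t : ℕ) : 0 ≤ stepDist D t := by
  unfold stepDist
  split_ifs
  · exact Finset.sum_nonneg fun _ _ => abs_nonneg _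
  · exact le_rfl

lemma aveDis_nonneg {S M : ℕ} (D : Fin S → Hist M) (p : Division S) : 0 ≤ aveDis D p := by
  have := one_le_len p
  have h := Finset.sum_nonneg fun t (_ : t ∈ Finset.Ico (p.1.1 : ℕ) p.1.2) => stepDist_nonneg D t
  unfold aveDis; positivity

lemma one_le_simVar {S M : ℕ} (D : Fin S → Hist M) (p : Division S) : 1 ≤ simVar D p := by
  unfold simVar
  split_ifs with h
  · exact le_rfl
  · push Not at h; exact h.2

lemma aveDis_le {S M : ℕ} (D : Fin S → Hist M) (p : Division S) :
    aveDis D p ≤ p.len * rawVar D p := by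
  have hl : 0 < p.len := lt_of_lt_of_le one_pos (one_le_len p)
  have hc : (((Finset.Ico (p.1.1 : ℕ) p.1.2).card : ℕ) : ℝ) = p.len - 1 := by
    have h : (p.1.1 : ℕ) ≤ p.1.2 := p.2
    rw [Nat.card_Ico, Nat.cast_sub h]; unfold Division.len; ring
  have hs : ∑ t ∈ Finset.Ico (p.1.1 : ℕ) p.1.2, stepDist D t = p.len * aveDis D p := by
    unfold aveDis; field_simp
  have hr : ∑ t ∈ Finset.Ico (p.1.1 : ℕ) p.1.2, |aveDis D p - stepDist D t|
      = p.len * rawVar D p := by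
    unfold rawVar; field_simp
  have h := Finset.abs_sum_le_sum_abs (fun t => aveDis D p - stepDist D t)
    (Finset.Ico (p.1.1 : ℕ) p.1.2)
  rw [hr, Finset.sum_sub_distrib, hs, Finset.sum_const, nsmul_eq_mul, hc] at h
  have h' := neg_abs_le ((p.len - 1) * aveDis D p - p.len * aveDis D p)
  linarith

lemma ratio_le_len {S M : ℕ} (D : Fin S → Hist M) (p : Division S) :
    aveDis D p / simVar D p ≤ p.len := by
  have hl := one_le_len p
  have hv := one_le_simVar D p
  have ha := aveDis_le D p
  rw [div_le_iff₀ (by linarith)]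
  by_cases h : p.1.1 = p.1.2
  · have : aveDis D p = 0 := by unfold aveDis; rw [h]; simp
    rw [this]; positivity
  · refine ha.trans (mul_le_mul_of_nonneg_left ?_ (by linarith))
    unfold simVar
    split_ifs with h'
    · exact (h'.resolve_left h).le
    · exact le_rfl

/-- The utility is bounded, so that its sensitivity is a genuine supremum. -/
lemma utilityGaps_bddAbove (S M : ℕ) {α : ℝ} (hα : 1 < α) : BddAbove (utilityGaps S M α) := by
  have key : ∀ (D : Fin S → Hist M) (p : Division S),
      0 ≤ utility α D p ∧ utility α D p ≤ Real.logb α S * S := by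
    intro D p
    have hl := one_le_len p
    have h0 : 0 ≤ Real.logb α p.len := Real.logb_nonneg hα hl
    have h1 : Real.logb α p.len ≤ Real.logb α S :=
      Real.logb_le_logb_of_le hα (by linarith) (len_le p)
    have hr : 0 ≤ aveDis D p / simVar D p :=
      div_nonneg (aveDis_nonneg D p) (by linarith [one_le_simVar D p])
    refine ⟨mul_nonneg h0 hr, ?_⟩
    exact mul_le_mul h1 ((ratio_le_len D p).trans (len_le p)) hr (h0.trans h1)
  refine ⟨Real.logb α S * S, ?_⟩
  rintro g ⟨p, D, D', -, rfl⟩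
  rw [abs_le]
  constructor <;> linarith [key (aggregate D) p, key (aggregate D') p]

/-- The exponential mechanism for the time division: `(i, j)` is selected with probability
proportional to `exp (ε U(i, j) / (2 Δ))`. -/
def divideTime {S M : ℕ} (α Δ ε : ℝ) (D : Fin S → Hist M) : Measure (Division S) :=
  ∑ p : Division S, ENNReal.ofReal
    (Real.exp (ε * utility α D p / (2 * Δ)) /
      ∑ q : Division S, Real.exp (ε * utility α D q / (2 * Δ))) • Measure.dirac p

/-! ### Prediction by linear regression -/

/-- The data-independent inputs of a linear regression `x ↦ θ.1 + θ.2 x` trained by gradient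
descent on `H` samples: the features of the historical days and of the current day, the learning
rate, the initial parameters, and the sequence of samples used by the successive iterations. -/
structure Regression (H : ℕ) where
  feature : Fin H → ℝ
  today : ℝ
  rate : ℝ
  init : ℝ × ℝ
  schedule : List (Fin H)

/-- The parameters obtained from the targets `t` by the iterations
`θ := θ + β (t⁽ⁱ⁾ - T(x⁽ⁱ⁾)) x⁽ⁱ⁾`, where `x⁽ⁱ⁾ = (1, xᵢ)`. -/
def Regression.train {H : ℕ} (R : Regression H) (t : Fin H → ℝ) : ℝ × ℝ :=
  R.schedule.foldl
    (fun θ i => θ + (R.rate * (t i - (θ.1 + θ.2 * R.feature i))) • ((1, R.feature i) : ℝ × ℝ))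
    R.init

/-- The value predicted for the current day. -/
def Regression.predict {H : ℕ} (R : Regression H) (t : Fin H → ℝ) : ℝ :=
  (R.train t).1 + (R.train t).2 * R.today

/-- The time stamp nearest to `y`. In the regression, the time stamps are numbered `1, …, S`. -/
def toStamp {S : ℕ} (hS : 0 < S) (y : ℝ) : Fin S :=
  ⟨(max 1 (min (S : ℤ) (round y)) - 1).toNat, by omega⟩

/-- The division points predicted for the current day from those of the historical days; the
second one is moved up to the first one if it would precede it. -/
def predictDivision {S H : ℕ} (hS : 0 < S) (R₁ R₂ : Regression H) (t : Fin H → Division S) :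
    Division S :=
  let t₁ := toStamp hS (R₁.predict fun h => ((t h).1.1 : ℕ) + 1)
  let t₂ := toStamp hS (R₂.predict fun h => ((t h).1.2 : ℕ) + 1)
  ⟨(t₁, max t₁ t₂), le_max_left _ _⟩

/-! ### Dynamic hybrid perturbation -/

/-- The `n` histograms from time stamp `s` on. -/
def segment {S M : ℕ} (D : Fin S → Hist M) (s n : ℕ) (h : s + n ≤ S) : Fin n → Hist M :=
  fun i => D ⟨s + i, by omega⟩

/-- The number of time stamps from the first to the second division point. -/
def Division.dayLen {S : ℕ} (p : Division S) : ℕ := (p.1.2 : ℕ) + 1 - p.1.1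

/-- The number of time stamps after the second division point. -/
def Division.restLen {S : ℕ} (p : Division S) : ℕ := S - ((p.1.2 : ℕ) + 1)

lemma Division.day_le {S : ℕ} (p : Division S) : (p.1.1 : ℕ) + p.dayLen ≤ S := by
  have h : (p.1.1 : ℕ) ≤ p.1.2 := p.2
  unfold Division.dayLen; omega

lemma Division.rest_le {S : ℕ} (p : Division S) : (p.1.2 : ℕ) + 1 + p.restLen ≤ S := by
  unfold Division.restLen; omega

/-- Put the publications of the three periods together in the order of time. -/
def assemble {S M : ℕ} (p : Division S)
    (o : (Fin (p.1.1 : ℕ) → Hist M) × (Fin p.dayLen → Hist M) × (Fin p.restLen → Hist M)) :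
    Fin S → Hist M :=
  fun s =>
    if h₁ : (s : ℕ) < p.1.1 then o.1 ⟨s, h₁⟩
    else if h₂ : (s : ℕ) ≤ p.1.2 then
      o.2.1 ⟨s - p.1.1, by unfold Division.dayLen; omega⟩
    else o.2.2 ⟨s - (p.1.2 + 1), by unfold Division.restLen; omega⟩

/-- Publication of the current day's data for given division points: threshold perturbation before
the first, direct perturbation between the two, threshold perturbation after the second, with
independent noise. The histogram sensitivity is `1` and the distance sensitivity is `2`. -/
def publish {S M : ℕ} (a T εt₁ εd εt₂ : ℝ) (c₁ c₂ : ℕ) (D : Fin S → Hist M) (p : Division S) :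
    Measure (Fin S → Hist M) :=
  ((thresholdPerturbation a T 2 εt₁ c₁ _ (segment D 0 p.1.1 (by omega))).prod
    ((directPerturbation 1 εd (segment D p.1.1 p.dayLen p.day_le)).prod
      (thresholdPerturbation a T 2 εt₂ c₂ _
        (segment D (p.1.2 + 1) p.restLen p.rest_le)))).map (assemble p)

/-- The dynamic hybrid perturbation mechanism: time divisions of the historical days with budget
`εt₁ + εd + εt₂` each, prediction for the current day, publication of the current day's data. -/
def dynamicHybrid {S M H : ℕ} (hS : 0 < S) (α Δ a T εt₁ εd εt₂ : ℝ) (c₁ c₂ : ℕ)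
    (R₁ R₂ : Regression H) (B : Database S M H) : Measure (Fin S → Hist M) :=
  (Measure.pi fun h => divideTime α Δ (εt₁ + εd + εt₂) (aggregate (B.past h))).bind fun t =>
    publish a T εt₁ εd εt₂ c₁ c₂ (aggregate B.current) (predictDivision hS R₁ R₂ t)

end

end MobilityDP

namespace MobilityDP

/-! ### Comparison of measures up to a privacy loss -/

/-! Privacy is expressed by `CloseBy`, a multiplicative domination of measures whose exponents add
under `bind`, `prod` and `pi`. Adjacency is symmetric, so one direction of domination suffices.

Neighbouring databases differ on a single day, so the budget `ε` is spent only once. If the day is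
historical, only one factor of the product of time divisions changes; the exponential mechanism
bounds its loss by `ε` (`closeBy_divideTime`), and regression and publication are post-processing.
If it is the current day, the law of the division points is unchanged. For each fixed division, a
trajectory moves every histogram by at most 1 in `l1Dist`, and the losses of the three periods add
up to `εt₁ + εd + εt₂` (`closeBy_publish`).

The delicate case is threshold perturbation, handled as in the sparse vector technique. Given the
same published past, `closeBy_thresholdLoop` compares the run on `D` at threshold `thr` with the run
on `D'` at `thr + 1`. Distances to the last publication differ by at most 1, so staying below the
threshold on `D` implies staying below the raised one on `D'` for the same noise: negative answers
are free, however many there are. A positive answer costs `ε₁ / (2c)` for shifting the comparison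
noise by 2, `ε₂ / (2c)` for the new histogram and `ε₁ / (2c)` for coupling the next threshold with
its shift by 1. This total is below the share `(ε₁ + ε₂) / c` of one perturbation. -/

/-- The measure `μ` is at most `exp e` times the measure `ν`. -/
def CloseBy {Ω : Type*} [MeasurableSpace Ω] (e : ℝ) (μ ν : Measure Ω) : Prop :=
  μ ≤ ENNReal.ofReal (Real.exp e) • ν

section CloseBy

variable {Ω Ω' : Type*} [MeasurableSpace Ω] [MeasurableSpace Ω'] {e e' : ℝ} {μ ν ξ : Measure Ω}

lemma CloseBy.apply_le (h : CloseBy e μ ν) (s : Set Ω) :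
    μ s ≤ ENNReal.ofReal (Real.exp e) * ν s := by
  simpa using h s

lemma closeBy_iff : CloseBy e μ ν ↔
    ∀ s, MeasurableSet s → μ s ≤ ENNReal.ofReal (Real.exp e) * ν s := by
  simp [CloseBy, Measure.le_iff]

lemma ofReal_exp_add (e e' : ℝ) : ENNReal.ofReal (Real.exp (e + e')) =
    ENNReal.ofReal (Real.exp e) * ENNReal.ofReal (Real.exp e') := by
  rw [Real.exp_add, ENNReal.ofReal_mul (Real.exp_pos _).le]

lemma CloseBy.mono (h : CloseBy e μ ν) (he : e ≤ e') : CloseBy e' μ ν :=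
  closeBy_iff.2 fun s _ => (h.apply_le s).trans (by gcongr)

lemma CloseBy.refl (he : 0 ≤ e) (μ : Measure Ω) : CloseBy e μ μ :=
  CloseBy.mono (closeBy_iff.2 fun s _ => by simp) he

lemma CloseBy.trans (h : CloseBy e μ ν) (h' : CloseBy e' ν ξ) : CloseBy (e + e') μ ξ :=
  closeBy_iff.2 fun s _ => by
    rw [ofReal_exp_add, mul_assoc]
    exact (h.apply_le s).trans (mul_le_mul_right (h'.apply_le s) _)

lemma CloseBy.map (h : CloseBy e μ ν) {f : Ω → Ω'} (hf : Measurable f) :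
    CloseBy e (μ.map f) (ν.map f) :=
  closeBy_iff.2 fun s hs => by
    rw [Measure.map_apply hf hs, Measure.map_apply hf hs]; exact h.apply_le _

lemma CloseBy.bind_left (h : CloseBy e μ ν) {f : Ω → Measure Ω'} (hf : Measurable f) :
    CloseBy e (μ.bind f) (ν.bind f) :=
  closeBy_iff.2 fun s hs => by
    rw [Measure.bind_apply hs hf.aemeasurable, Measure.bind_apply hs hf.aemeasurable,
      ← smul_eq_mul, ← lintegral_smul_measure]
    exact lintegral_mono' h le_rfl

lemma CloseBy.bind_right {f g : Ω → Measure Ω'} (hf : Measurable f) (hg : Measurable g)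
    (h : ∀ x, CloseBy e (f x) (g x)) : CloseBy e (μ.bind f) (μ.bind g) :=
  closeBy_iff.2 fun s hs => by
    rw [Measure.bind_apply hs hf.aemeasurable, Measure.bind_apply hs hg.aemeasurable,
      ← lintegral_const_mul' _ _ ENNReal.ofReal_ne_top]
    exact lintegral_mono fun x => (h x).apply_le s

lemma CloseBy.bind (h : CloseBy e μ ν) {f g : Ω → Measure Ω'} (hf : Measurable f)
    (hg : Measurable g) (hfg : ∀ x, CloseBy e' (f x) (g x)) :
    CloseBy (e + e') (μ.bind f) (ν.bind g) :=
  (h.bind_left hf).trans (CloseBy.bind_right hf hg hfg)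

lemma CloseBy.prod {μ' ν' : Measure Ω'} [SFinite μ'] [SFinite ν'] (h : CloseBy e μ ν)
    (h' : CloseBy e' μ' ν') : CloseBy (e + e') (μ.prod μ') (ν.prod ν') := by
  rw [Measure.prod, Measure.prod]
  exact h.bind Measurable.map_prodMk_left Measurable.map_prodMk_left
    fun _ => h'.map measurable_prodMk_left

/-- The constants multiply out to one scalar in front of the product measure, and on boxes the bound
is a product of bounds. It passes to all measurable sets because `OuterMeasure.pi` is the largest
outer measure bounded on nonempty boxes by the product of the side measures. -/
lemma CloseBy.pi {ι : Type*} [Fintype ι] {X : ι → Type*} [∀ i, MeasurableSpace (X i)]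
    {μ ν : ∀ i, Measure (X i)} [∀ i, IsFiniteMeasure (μ i)] [∀ i, IsFiniteMeasure (ν i)]
    {e : ι → ℝ} (h : ∀ i, CloseBy (e i) (μ i) (ν i)) :
    CloseBy (∑ i, e i) (Measure.pi μ) (Measure.pi ν) := by
  have fin : ∀ i, IsFiniteMeasure (ENNReal.ofReal (Real.exp (e i)) • ν i) :=
    fun i => Measure.smul_finite _ ENNReal.ofReal_ne_top
  have hpi : Measure.pi (fun i => ENNReal.ofReal (Real.exp (e i)) • ν i)
      = ENNReal.ofReal (Real.exp (∑ i, e i)) • Measure.pi ν := by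
    refine Measure.pi_eq fun s _ => ?_
    simp [Measure.pi_pi, Finset.prod_mul_distrib, Real.exp_sum,
      ENNReal.ofReal_prod_of_nonneg fun i _ => (Real.exp_pos (e i)).le]
  unfold CloseBy
  rw [← hpi]
  refine Measure.le_iff.2 fun s hs => ?_
  have hle : (Measure.pi μ).toOuterMeasure ≤
      OuterMeasure.pi fun i => (ENNReal.ofReal (Real.exp (e i)) • ν i).toOuterMeasure := by
    rw [OuterMeasure.le_pi]
    intro t _
    exact (Measure.pi_pi μ t).trans_le (Finset.prod_le_prod' fun i _ => h i (t i))
  refine (hle s).trans ?_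
  rw [Measure.pi]
  exact le_toMeasure_apply _ _ _

lemma bind_ite {A : Set Ω} (hA : MeasurableSet A) [DecidablePred (· ∈ A)] (G K : Measure Ω') :
    (μ.bind fun x => if x ∈ A then G else K) = μ A • G + μ Aᶜ • K := by
  ext s hs
  have hm : Measurable fun x => if x ∈ A then G else K :=
    Measurable.ite hA measurable_const measurable_const
  rw [Measure.bind_apply hs hm.aemeasurable, ← lintegral_add_compl _ hA,
    setLIntegral_congr_fun (g := fun _ => G s) hA fun x hx => by simp [hx],
    setLIntegral_congr_fun (g := fun _ => K s) hA.compl fun x hx => by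
      simp [show x ∉ A from hx]]
  simp [mul_comm]

/-- Both sides are two-term mixtures. Only the branch `A` pays `e₀` for the test itself; the other
pays nothing for it, since `A' ⊆ A` makes `Aᶜ` the smaller event. -/
lemma CloseBy.bind_ite {A A' : Set Ω} (hA : MeasurableSet A) (hA' : MeasurableSet A')
    [DecidablePred (· ∈ A)] [DecidablePred (· ∈ A')] {G G' K K' : Measure Ω'} {e₀ e₁ : ℝ}
    (h₀ : μ A ≤ ENNReal.ofReal (Real.exp e₀) * μ A') (hG : CloseBy e₁ G G') (he : e₀ + e₁ ≤ e)
    (hsub : A' ⊆ A) (hK : CloseBy e K K') :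
    CloseBy e (μ.bind fun x => if x ∈ A then G else K)
      (μ.bind fun x => if x ∈ A' then G' else K') := by
  rw [MobilityDP.bind_ite hA, MobilityDP.bind_ite hA']
  refine closeBy_iff.2 fun s _ => ?_
  simp only [Measure.add_apply, Measure.smul_apply, smul_eq_mul, mul_add]
  refine add_le_add ?_ ?_
  · calc μ A * G s ≤ (ENNReal.ofReal (Real.exp e₀) * μ A') *
          (ENNReal.ofReal (Real.exp e₁) * G' s) := mul_le_mul' h₀ (hG.apply_le s)
      _ = ENNReal.ofReal (Real.exp (e₀ + e₁)) * (μ A' * G' s) := by rw [ofReal_exp_add]; ring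
      _ ≤ _ := by gcongr
  · calc μ Aᶜ * K s ≤ μ A'ᶜ * (ENNReal.ofReal (Real.exp e) * K' s) :=
          mul_le_mul' (measure_mono (Set.compl_subset_compl.2 hsub)) (hK.apply_le s)
      _ = _ := by ring

end CloseBy

/-! ### Measurability of parametrized mechanisms -/

section Measurability

variable {X Y Z : Type*} [MeasurableSpace X] [MeasurableSpace Y] [MeasurableSpace Z]

lemma measurable_bind_param {μ : Measure Y} [SFinite μ] {f : X → Y → Measure Z}
    (hf : Measurable fun q : X × Y => f q.1 q.2) : Measurable fun x => μ.bind (f x) := by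
  refine Measure.measurable_of_measurable_coe _ fun s hs => ?_
  have h : (fun x => μ.bind (f x) s) = fun x => ∫⁻ y, f x y s ∂μ := by
    funext x
    exact Measure.bind_apply hs (hf.comp measurable_prodMk_left).aemeasurable
  rw [h]
  exact ((Measure.measurable_coe hs).comp hf).lintegral_prod_right'

lemma measurable_map_param {m : X → Measure Y} (hm : Measurable m)
    [∀ x, IsProbabilityMeasure (m x)] {f : X → Y → Z}
    (hf : Measurable fun q : X × Y => f q.1 q.2) : Measurable fun x => (m x).map (f x) := by
  refine Measure.measurable_of_measurable_coe _ fun s hs => ?_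
  let κ : ProbabilityTheory.Kernel X Y := ⟨m, hm⟩
  have : ProbabilityTheory.IsMarkovKernel κ :=
    ⟨fun x => inferInstanceAs (IsProbabilityMeasure (m x))⟩
  have h : (fun x => (m x).map (f x) s)
      = fun x => κ x (Prod.mk x ⁻¹' ((fun q : X × Y => f q.1 q.2) ⁻¹' s)) := by
    funext x
    exact Measure.map_apply (hf.comp measurable_prodMk_left) hs
  rw [h]
  exact ProbabilityTheory.Kernel.measurable_kernel_prodMk_left (hf hs)

lemma isProbabilityMeasure_bind' {μ : Measure X} [IsProbabilityMeasure μ] {f : X → Measure Y}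
    (hf : Measurable f) (h : ∀ x, IsProbabilityMeasure (f x)) :
    IsProbabilityMeasure (μ.bind f) :=
  isProbabilityMeasure_bind hf.aemeasurable (Filter.Eventually.of_forall h)

end Measurability

/-! ### Laplace noise -/

lemma isProbabilityMeasure_laplace {b : ℝ} (hb : 0 < b) : IsProbabilityMeasure (laplace b) := by
  have hI : ∫ x in Set.Ioi (0 : ℝ), Real.exp (-b⁻¹ * x) = b := by
    rw [integral_exp_mul_Ioi (by simpa using hb)]
    simp
  have habs : ∫ x : ℝ, Real.exp (-b⁻¹ * |x|) = 2 * b := by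
    rw [integral_comp_abs (f := fun x => Real.exp (-b⁻¹ * x)), hI]
  have hint : Integrable fun x : ℝ => Real.exp (-b⁻¹ * |x|) := by
    -- A non-integrable function has integral 0 by convention, so the nonzero value just computed
    -- yields integrability.
    refine (not_imp_comm.1 integral_undef ?_)
    rw [habs]; positivity
  have hfun : (fun x : ℝ => 1 / (2 * b) * Real.exp (-|x| / b))
      = fun x => 1 / (2 * b) * Real.exp (-b⁻¹ * |x|) := by
    funext x; congr 2; field_simp
  constructor
  rw [laplace, withDensity_apply _ MeasurableSet.univ, Measure.restrict_univ,
    ← ofReal_integral_eq_lintegral_ofReal (hfun ▸ hint.const_mul _)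
      (Filter.Eventually.of_forall fun x => by positivity), hfun, integral_const_mul, habs]
  rw [one_div, inv_mul_cancel₀ (by positivity), ENNReal.ofReal_one]

/-- By translation invariance the shifted law has density `p (y - s)`, and `|y| ≤ |y - s| + |s|`
bounds the ratio of the densities pointwise. -/
lemma laplace_shift {b : ℝ} (hb : 0 < b) (s : ℝ) :
    CloseBy (|s| / b) ((laplace b).map fun x => s + x) (laplace b) := by
  refine closeBy_iff.2 fun O hO => ?_
  have hs : Measurable fun x : ℝ => s + x := measurable_const_add s
  let p : ℝ → ℝ≥0∞ := fun x => ENNReal.ofReal (1 / (2 * b) * Real.exp (-|x| / b))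
  have hp : Measurable p := by fun_prop
  have hle : ∀ y, p (y - s) ≤ ENNReal.ofReal (Real.exp (|s| / b)) * p y := by
    intro y
    rw [← ENNReal.ofReal_mul (Real.exp_pos _).le]
    refine ENNReal.ofReal_le_ofReal ?_
    rw [mul_left_comm, ← Real.exp_add, ← add_div]
    have : |y| ≤ |y - s| + |s| := by simpa using abs_add_le (y - s) s
    gcongr
    linarith
  rw [Measure.map_apply hs hO, laplace, withDensity_apply _ (hs hO), withDensity_apply _ hO,
    ← lintegral_const_mul _ hp]
  calc ∫⁻ x in (fun x => s + x) ⁻¹' O, p x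
      = ∫⁻ x, O.indicator (fun y => p (y - s)) (s + x) := by
        rw [← lintegral_indicator (hs hO)]
        refine lintegral_congr fun x => ?_
        by_cases hx : s + x ∈ O <;> simp [hx]
    _ = ∫⁻ y in O, p (y - s) := by
        rw [lintegral_add_left_eq_self (fun y => O.indicator (fun y => p (y - s)) y) s,
          lintegral_indicator hO]
    _ ≤ _ := lintegral_mono hle

/-- The coupling argument: noise `x` on one side is matched with `s + x` on the other, at the price
of a Laplace shift. -/
lemma CloseBy.laplace_bind {Ω : Type*} [MeasurableSpace Ω] {b e s : ℝ} (hb : 0 < b)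
    {f g : ℝ → Measure Ω} (hf : Measurable f) (hg : Measurable g)
    (h : ∀ x, CloseBy e (f x) (g (s + x))) :
    CloseBy (e + |s| / b) ((laplace b).bind f) ((laplace b).bind g) := by
  have hs : Measurable fun x : ℝ => s + x := measurable_const_add s
  have h₁ : CloseBy e ((laplace b).bind f) ((laplace b).bind fun x => g (s + x)) :=
    CloseBy.bind_right hf (hg.comp hs) h
  have h₂ : ((laplace b).bind fun x => g (s + x)) = ((laplace b).map fun x => s + x).bind g := by
    rw [Measure.bind, Measure.bind, Measure.map_map hg hs]; rfl
  rw [h₂] at h₁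
  exact h₁.trans ((laplace_shift hb s).bind_left hg)

lemma isProbabilityMeasure_perturb {M : ℕ} {b : ℝ} (hb : 0 < b) (x : Hist M) :
    IsProbabilityMeasure (perturb b x) := by
  have := isProbabilityMeasure_laplace hb
  exact Measure.isProbabilityMeasure_map (measurable_const_add x).aemeasurable

lemma closeBy_perturb {M : ℕ} {b : ℝ} (hb : 0 < b) (x y : Hist M) :
    CloseBy (l1Dist x y / b) (perturb b x) (perturb b y) := by
  have := isProbabilityMeasure_laplace hb
  have hm : ∀ t : ℝ, Measurable fun z : ℝ => t + z := fun t => measurable_const_add t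
  have hprob : ∀ t : ℝ, IsProbabilityMeasure ((laplace b).map fun z => t + z) :=
    fun t => Measure.isProbabilityMeasure_map (hm t).aemeasurable
  have hpi : ∀ x : Hist M, perturb b x
      = Measure.pi fun m => (laplace b).map fun z => x m + z := by
    intro x
    exact Measure.pi_map_pi (μ := fun _ : Fin M => laplace b) (f := fun m z => x m + z)
      fun m => (hm (x m)).aemeasurable
  rw [hpi, hpi, l1Dist, Finset.sum_div]
  refine CloseBy.pi fun m => ?_
  -- Shifting by `x m` is shifting by `x m - y m` and then by `y m`; the second shift is common to
  -- both sides.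
  have h := (laplace_shift hb (x m - y m)).map (hm (y m))
  rw [Measure.map_map (hm _) (hm _)] at h
  convert h using 2
  funext z
  simp only [Function.comp_apply]; ring

/-! ### Threshold perturbation -/

lemma measurable_cons {X : Type*} [MeasurableSpace X] {M k : ℕ} {f : X → Hist M}
    {g : X → Fin k → Hist M} (hf : Measurable f) (hg : Measurable g) :
    Measurable fun x => (Fin.cons (f x) (g x) : Fin (k + 1) → Hist M) := by
  refine measurable_pi_iff.2 fun i => ?_
  refine Fin.cases ?_ (fun j => ?_) i
  · simpa using hf
  · exact (measurable_pi_apply j).comp hg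

lemma measurable_l1Dist {M : ℕ} (y : Hist M) : Measurable fun x : Hist M => l1Dist x y := by
  unfold l1Dist
  refine Finset.measurable_sum _ fun m _ => ?_
  simp only [← Real.norm_eq_abs]
  exact ((measurable_pi_apply m).sub_const _).norm

lemma l1Dist_le_add {M : ℕ} (x y z : Hist M) : l1Dist x z ≤ l1Dist x y + l1Dist y z := by
  unfold l1Dist
  rw [← Finset.sum_add_distrib]
  exact Finset.sum_le_sum fun m _ => abs_sub_le _ _ _

lemma l1Dist_comm {M : ℕ} (x y : Hist M) : l1Dist x y = l1Dist y x :=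
  Finset.sum_congr rfl fun _ _ => abs_sub_comm _ _

section Threshold

variable {M : ℕ} {ε₁ ε₂ T ΔD : ℝ} {c : ℕ}

/-- The two claims share one induction because `measurable_map_param` needs the recursive law to be
a Markov kernel, jointly in the last publication and the threshold. -/
lemma thresholdLoop_measurable_isProbability (h₁ : 0 < ε₁) (h₂ : 0 < ε₂) (hΔ : 0 < ΔD)
    (hc : 0 < c) (k : ℕ) : ∀ (D : Fin k → Hist M) (cnt : ℕ),
      (Measurable fun q : Hist M × ℝ => thresholdLoop ε₁ ε₂ T ΔD c k D q.1 cnt q.2) ∧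
      ∀ q : Hist M × ℝ, IsProbabilityMeasure (thresholdLoop ε₁ ε₂ T ΔD c k D q.1 cnt q.2) := by
  have hc' : (0 : ℝ) < c := by exact_mod_cast hc
  have hν := isProbabilityMeasure_laplace (b := 2 * c * ΔD / ε₁) (by positivity)
  have hρ := isProbabilityMeasure_laplace (b := c * ΔD / ε₁) (by positivity)
  induction k with
  | zero =>
    intro D cnt
    simp only [thresholdLoop]
    exact ⟨measurable_const, fun _ => inferInstance⟩
  | succ k ih =>
    intro D cnt
    have hkeepP : ∀ q : Hist M × ℝ, IsProbabilityMeasure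
        ((thresholdLoop ε₁ ε₂ T ΔD c k (Fin.tail D) q.1 cnt q.2).map
          fun out => (Fin.cons q.1 out : Fin (k + 1) → Hist M)) := fun q =>
      have := (ih (Fin.tail D) cnt).2 q
      Measure.isProbabilityMeasure_map
        (measurable_cons measurable_const measurable_id).aemeasurable
    have hkeepM : Measurable fun q : Hist M × ℝ =>
        (thresholdLoop ε₁ ε₂ T ΔD c k (Fin.tail D) q.1 cnt q.2).map
          fun out => (Fin.cons q.1 out : Fin (k + 1) → Hist M) :=
      have := (ih (Fin.tail D) cnt).2
      measurable_map_param (ih (Fin.tail D) cnt).1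
        (measurable_cons (measurable_fst.comp measurable_fst) measurable_snd)
    simp only [thresholdLoop]
    split_ifs with hcnt hk
    · exact ⟨hkeepM, hkeepP⟩
    · refine ⟨measurable_const, fun _ => ?_⟩
      have hlt : (cnt : ℝ) < c := by exact_mod_cast not_le.1 hcnt
      have := isProbabilityMeasure_perturb
        (b := ΔD / ((ε₁ + ε₂) * (c - cnt) / c))
        (div_pos hΔ (div_pos (mul_pos (by positivity) (sub_pos.2 hlt)) hc')) (D 0)
      exact Measure.isProbabilityMeasure_map
        (measurable_pi_lambda _ fun _ => measurable_id).aemeasurable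
    · have hX := isProbabilityMeasure_perturb (b := c * ΔD / ε₂) (by positivity) (D 0)
      have hnewP : ∀ (x : Hist M) (ρ : ℝ), IsProbabilityMeasure
          ((thresholdLoop ε₁ ε₂ T ΔD c k (Fin.tail D) x (cnt + 1) (T + ρ)).map
            fun out => (Fin.cons x out : Fin (k + 1) → Hist M)) := fun x ρ =>
        have := (ih (Fin.tail D) (cnt + 1)).2 (x, T + ρ)
        Measure.isProbabilityMeasure_map
          (measurable_cons measurable_const measurable_id).aemeasurable
      have hnewM : Measurable fun q : Hist M × ℝ =>
          (thresholdLoop ε₁ ε₂ T ΔD c k (Fin.tail D) q.1 (cnt + 1) (T + q.2)).map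
            fun out => (Fin.cons q.1 out : Fin (k + 1) → Hist M) := by
        have hp : Measurable fun q : Hist M × ℝ => (q.1, T + q.2) :=
          measurable_fst.prodMk (measurable_snd.const_add T)
        have := fun q : Hist M × ℝ => (ih (Fin.tail D) (cnt + 1)).2 (q.1, T + q.2)
        exact measurable_map_param
          (m := fun q : Hist M × ℝ =>
            thresholdLoop ε₁ ε₂ T ΔD c k (Fin.tail D) q.1 (cnt + 1) (T + q.2))
          ((ih (Fin.tail D) (cnt + 1)).1.comp hp)
          (measurable_cons (measurable_fst.comp measurable_fst) measurable_snd)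
      have hG : IsProbabilityMeasure ((perturb (c * ΔD / ε₂) (D 0)).bind fun x =>
          (laplace (c * ΔD / ε₁)).bind fun ρ =>
            (thresholdLoop ε₁ ε₂ T ΔD c k (Fin.tail D) x (cnt + 1) (T + ρ)).map
              fun out => (Fin.cons x out : Fin (k + 1) → Hist M)) :=
        isProbabilityMeasure_bind' (measurable_bind_param hnewM) fun x =>
          isProbabilityMeasure_bind' (hnewM.comp measurable_prodMk_left) (hnewP x)
      have hset : MeasurableSet {q : (Hist M × ℝ) × ℝ | q.1.2 ≤ l1Dist q.1.1 (D 0) + q.2} :=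
        measurableSet_le (measurable_snd.comp measurable_fst)
          (((measurable_l1Dist _).comp (measurable_fst.comp measurable_fst)).add measurable_snd)
      refine ⟨measurable_bind_param
        (Measurable.ite hset measurable_const (hkeepM.comp measurable_fst)), fun q => ?_⟩
      refine isProbabilityMeasure_bind' (Measurable.ite (hset.preimage measurable_prodMk_left)
        measurable_const measurable_const) fun ν => ?_
      split_ifs
      · exact hG
      · exact hkeepP q

lemma measurable_thresholdLoop_cons (h₁ : 0 < ε₁) (h₂ : 0 < ε₂) (hΔ : 0 < ΔD)
    (hc : 0 < c) {k : ℕ} (D : Fin k → Hist M) (cnt : ℕ) :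
    Measurable fun q : Hist M × ℝ =>
      (thresholdLoop ε₁ ε₂ T ΔD c k D q.1 cnt (T + q.2)).map
        fun out => (Fin.cons q.1 out : Fin (k + 1) → Hist M) := by
  obtain ⟨hm, hp⟩ := thresholdLoop_measurable_isProbability (T := T) h₁ h₂ hΔ hc k D cnt
  have := fun q : Hist M × ℝ => hp (q.1, T + q.2)
  exact measurable_map_param
    (m := fun q : Hist M × ℝ => thresholdLoop ε₁ ε₂ T ΔD c k D q.1 cnt (T + q.2))
    (hm.comp (measurable_fst.prodMk (measurable_snd.const_add T)))
    (measurable_cons (measurable_fst.comp measurable_fst) measurable_snd)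

/-- Publishing a perturbed histogram, drawing a new threshold and continuing costs the budget of
one perturbation, of one threshold, and of what follows with the threshold moved by one. -/
lemma closeBy_publish_and_continue (h₁ : 0 < ε₁) (h₂ : 0 < ε₂) (hc : 0 < c) {k cnt : ℕ} {e : ℝ}
    {x x' : Hist M} (hx : l1Dist x x' ≤ 1) {D D' : Fin k → Hist M}
    (h : ∀ prev thr, CloseBy e (thresholdLoop ε₁ ε₂ T 2 c k D prev cnt thr)
      (thresholdLoop ε₁ ε₂ T 2 c k D' prev cnt (thr + 1))) :
    CloseBy (e + (ε₁ + ε₂) / (2 * c))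
      ((perturb (c * 2 / ε₂) x).bind fun y => (laplace (c * 2 / ε₁)).bind fun ρ =>
        (thresholdLoop ε₁ ε₂ T 2 c k D y cnt (T + ρ)).map
          fun out => (Fin.cons y out : Fin (k + 1) → Hist M))
      ((perturb (c * 2 / ε₂) x').bind fun y => (laplace (c * 2 / ε₁)).bind fun ρ =>
        (thresholdLoop ε₁ ε₂ T 2 c k D' y cnt (T + ρ)).map
          fun out => (Fin.cons y out : Fin (k + 1) → Hist M)) := by
  have hc' : (0 : ℝ) < c := by exact_mod_cast hc
  have hρ := isProbabilityMeasure_laplace (b := c * 2 / ε₁) (by positivity)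
  have hm := measurable_thresholdLoop_cons (T := T) h₁ h₂ two_pos hc D cnt
  have hm' := measurable_thresholdLoop_cons (T := T) h₁ h₂ two_pos hc D' cnt
  have hpert := (closeBy_perturb (b := c * 2 / ε₂) (by positivity) x x').mono
    (div_le_div_of_nonneg_right hx (by positivity))
  refine (hpert.bind (measurable_bind_param hm) (measurable_bind_param hm') fun y =>
    CloseBy.laplace_bind (e := e) (s := 1) (by positivity) (hm.comp measurable_prodMk_left)
      (hm'.comp measurable_prodMk_left) fun ρ => ?_).mono (le_of_eq ?_)
  · have := (h y (T + ρ)).map (measurable_cons (f := fun _ => y) measurable_const measurable_id)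
    -- The threshold `T + ρ + 1` is the one produced by the shifted noise `1 + ρ`.
    rw [add_assoc, add_comm ρ] at this
    exact this
  · rw [abs_one]; field_simp; ring

lemma closeBy_thresholdLoop (h₁ : 0 < ε₁) (h₂ : 0 < ε₂) (hc : 0 < c) (k : ℕ) :
    ∀ (D D' : Fin k → Hist M), (∀ i, l1Dist (D i) (D' i) ≤ 1) → ∀ (cnt : ℕ), cnt ≤ c →
      ∀ (prev : Hist M) (thr : ℝ), CloseBy ((c - cnt) * (ε₁ + ε₂) / c)
        (thresholdLoop ε₁ ε₂ T 2 c k D prev cnt thr)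
        (thresholdLoop ε₁ ε₂ T 2 c k D' prev cnt (thr + 1)) := by
  have hc' : (0 : ℝ) < c := by exact_mod_cast hc
  induction k with
  | zero =>
    intro D D' _ cnt hcnt prev thr
    have : (0 : ℝ) ≤ c - cnt := sub_nonneg.2 (by exact_mod_cast hcnt)
    simp only [thresholdLoop]
    exact CloseBy.refl (by positivity) _
  | succ k ih =>
    intro D D' hD cnt hcnt prev thr
    have htail : ∀ i, l1Dist (Fin.tail D i) (Fin.tail D' i) ≤ 1 := fun i => hD i.succ
    have hkeep := (ih _ _ htail cnt hcnt prev thr).map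
      (measurable_cons (f := fun _ => prev) measurable_const measurable_id)
    simp only [thresholdLoop]
    split_ifs with hle hk
    · exact hkeep
    · have hlt : (0 : ℝ) < c - cnt := sub_pos.2 (by exact_mod_cast not_le.1 hle)
      have hm : Measurable fun (x : Hist M) (_ : Fin (k + 1)) => x :=
        measurable_pi_lambda _ fun _ => measurable_id
      -- The last histogram gets noise of scale 2 over the remaining budget, but moves by at most 1,
      -- so half of that budget is enough.
      refine CloseBy.mono ((closeBy_perturb (by positivity) _ _).map hm) ?_
      rw [div_div_eq_mul_div, mul_comm (ε₁ + ε₂)]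
      have h0 : 0 ≤ (c - cnt) * (ε₁ + ε₂) / c := by positivity
      have := mul_le_of_le_one_left h0 (hD 0)
      linarith
    · have hlt : cnt + 1 ≤ c := not_le.1 hle
      have hG := closeBy_publish_and_continue h₁ h₂ hc (hD 0) (ih _ _ htail (cnt + 1) hlt)
      have hA : ∀ (E : Fin (k + 1) → Hist M) (t : ℝ),
          MeasurableSet {ν : ℝ | t ≤ l1Dist prev (E 0) + ν} := fun E t =>
        measurableSet_le measurable_const (measurable_id.const_add _)
      have hd := l1Dist_le_add prev (D' 0) (D 0)
      have hd' := l1Dist_le_add prev (D 0) (D' 0)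
      have h01 := hD 0
      rw [l1Dist_comm (D' 0)] at hd
      -- The shift 2 makes up for the raised threshold and for a distance smaller by up to 1.
      refine CloseBy.bind_ite (e₀ := |2| / (2 * c * 2 / ε₁)) (hA D thr) (hA D' (thr + 1)) ?_ hG
        ?_ ?_ hkeep
      · have hs : Measurable fun x : ℝ => 2 + x := measurable_const_add 2
        refine le_trans ?_ ((laplace_shift (by positivity) 2).apply_le _)
        rw [Measure.map_apply hs (hA D' (thr + 1))]
        refine measure_mono fun ν hν => ?_
        simp only [Set.mem_preimage, Set.mem_ofPred_eq] at hν ⊢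
        linarith
      · have : |2| / (2 * c * 2 / ε₁) + ((c - (cnt + 1 : ℕ)) * (ε₁ + ε₂) / c
            + (ε₁ + ε₂) / (2 * c)) = (c - cnt) * (ε₁ + ε₂) / c - ε₂ / (2 * c) := by
          push_cast
          rw [abs_two]
          field_simp
          ring
        have h0 : 0 ≤ ε₂ / (2 * c) := by positivity
        linarith
      · intro ν hν
        simp only [Set.mem_ofPred_eq] at hν ⊢
        linarith

end Threshold

lemma isProbabilityMeasure_thresholdPerturbation {M : ℕ} {a T ε : ℝ} (ha₀ : 0 < a) (ha₁ : a < 1)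
    (hε : 0 < ε) {c : ℕ} (hc : 0 < c) {n : ℕ} (D : Fin n → Hist M) :
    IsProbabilityMeasure (thresholdPerturbation a T 2 ε c n D) := by
  have hc' : (0 : ℝ) < c := by exact_mod_cast hc
  have h₁ : 0 < a * ε := by positivity
  have h₂ : 0 < (1 - a) * ε := mul_pos (sub_pos.2 ha₁) hε
  cases n with
  | zero => simp only [thresholdPerturbation]; infer_instance
  | succ n =>
    have hX := isProbabilityMeasure_perturb (b := c * 2 / ((1 - a) * ε)) (by positivity) (D 0)
    have hρ := isProbabilityMeasure_laplace (b := c * 2 / (a * ε)) (by positivity)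
    have hm := measurable_thresholdLoop_cons (T := T) h₁ h₂ two_pos hc (Fin.tail D) 1
    simp only [thresholdPerturbation]
    refine isProbabilityMeasure_bind' (measurable_bind_param hm) fun x =>
      isProbabilityMeasure_bind' (hm.comp measurable_prodMk_left) fun ρ => ?_
    have := (thresholdLoop_measurable_isProbability (T := T) h₁ h₂ two_pos hc n
      (Fin.tail D) 1).2 (x, T + ρ)
    exact Measure.isProbabilityMeasure_map
      (measurable_cons measurable_const measurable_id).aemeasurable

lemma closeBy_thresholdPerturbation {M : ℕ} {a T ε : ℝ} (ha₀ : 0 < a) (ha₁ : a < 1)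
    (hε : 0 < ε) {c : ℕ} (hc : 0 < c) {n : ℕ} {D D' : Fin n → Hist M}
    (hD : ∀ i, l1Dist (D i) (D' i) ≤ 1) :
    CloseBy ε (thresholdPerturbation a T 2 ε c n D) (thresholdPerturbation a T 2 ε c n D') := by
  have h₁ : 0 < a * ε := by positivity
  have h₂ : 0 < (1 - a) * ε := mul_pos (sub_pos.2 ha₁) hε
  have hc' : (0 : ℝ) < c := by exact_mod_cast hc
  cases n with
  | zero => simp only [thresholdPerturbation]; exact CloseBy.refl hε.le _
  | succ n =>
    simp only [thresholdPerturbation]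
    refine (closeBy_publish_and_continue h₁ h₂ hc (hD 0)
      (closeBy_thresholdLoop h₁ h₂ hc n _ _ (fun i => hD i.succ) 1 hc)).mono ?_
    -- The first publication counts as one perturbation but makes no comparison: with its threshold
    -- it uses half a share.
    have : (c - (1 : ℕ)) * (a * ε + (1 - a) * ε) / c + (a * ε + (1 - a) * ε) / (2 * c)
        = ε - ε / (2 * c) := by
      push_cast; field_simp; ring
    rw [this]
    have : 0 ≤ ε / (2 * c) := by positivity
    linarith

/-! ### Direct perturbation -/

lemma isProbabilityMeasure_directPerturbation {M n : ℕ} {ε : ℝ} (hε : 0 < ε)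
    (D : Fin n → Hist M) : IsProbabilityMeasure (directPerturbation 1 ε D) := by
  have : ∀ i, IsProbabilityMeasure (perturb (n * 1 / ε) (D i)) := fun i =>
    have hn : (0 : ℝ) < n := by exact_mod_cast i.pos
    isProbabilityMeasure_perturb (by positivity) _
  unfold directPerturbation
  infer_instance

lemma closeBy_directPerturbation {M n : ℕ} {ε : ℝ} (hε : 0 < ε) {D D' : Fin n → Hist M}
    (hD : ∀ i, l1Dist (D i) (D' i) ≤ 1) :
    CloseBy ε (directPerturbation 1 ε D) (directPerturbation 1 ε D') := by
  have hb : ∀ _ : Fin n, 0 < n * 1 / ε := fun i =>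
    have hn : (0 : ℝ) < n := by exact_mod_cast i.pos
    by positivity
  have hp : ∀ (E : Fin n → Hist M) i, IsProbabilityMeasure (perturb (n * 1 / ε) (E i)) :=
    fun E i => isProbabilityMeasure_perturb (hb i) _
  have hD₁ := hp D
  have hD₂ := hp D'
  refine (CloseBy.pi (e := fun _ => ε / n) fun i =>
    (closeBy_perturb (hb i) _ _).mono ?_).mono ?_
  · exact (div_le_div_of_nonneg_right (hD i) (hb i).le).trans_eq (by rw [mul_one, one_div_div])
  · rw [Finset.sum_const, Finset.card_univ, Fintype.card_fin, nsmul_eq_mul]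
    -- For an empty period the total loss is 0, while `ε / n` takes the default value 0.
    rcases Nat.eq_zero_or_pos n with rfl | hn
    · simpa using hε.le
    · have : (n : ℝ) ≠ 0 := by positivity
      exact (mul_div_cancel₀ _ this).le

/-! ### Neighbouring days -/

lemma DayAdj.symm {S M : ℕ} {D D' : Day S M} (h : DayAdj D D') : DayAdj D' D :=
  let ⟨τ, hτ⟩ := h
  ⟨τ, hτ.symm⟩

/-- At each time a trajectory is at exactly one base station, so removing it changes one entry by 1.
-/
lemma DayAdj.l1Dist_le {S M : ℕ} {D D' : Day S M} (h : DayAdj D D') (i : Fin S) :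
    l1Dist (aggregate D i) (aggregate D' i) ≤ 1 := by
  have key : ∀ (τ : Trajectory S M) (E : Day S M),
      l1Dist (aggregate (τ ::ₘ E) i) (aggregate E i) ≤ 1 := by
    intro τ E
    have : ∀ m, |aggregate (τ ::ₘ E) i m - aggregate E i m| = if τ i = m then (1 : ℝ) else 0 := by
      intro m
      simp only [aggregate, Multiset.countP_cons]
      split_ifs <;> simp
    simp [l1Dist, this]
  obtain ⟨τ, rfl | rfl⟩ := h
  · exact key τ D'
  · rw [l1Dist_comm]; exact key τ D

/-! ### Publication of the current day -/

lemma measurable_assemble {S M : ℕ} (p : Division S) : Measurable (assemble (M := M) p) := by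
  refine measurable_pi_lambda _ fun s => ?_
  unfold assemble
  split_ifs
  · exact (measurable_pi_apply _).comp measurable_fst
  · exact (measurable_pi_apply _).comp (measurable_fst.comp measurable_snd)
  · exact (measurable_pi_apply _).comp (measurable_snd.comp measurable_snd)

section Publish

variable {S M : ℕ} {a T εt₁ εd εt₂ : ℝ} {c₁ c₂ : ℕ}

lemma isProbabilityMeasure_publish (ha₀ : 0 < a) (ha₁ : a < 1) (hεt₁ : 0 < εt₁) (hεd : 0 < εd)
    (hεt₂ : 0 < εt₂) (hc₁ : 0 < c₁) (hc₂ : 0 < c₂) (D : Fin S → Hist M) (p : Division S) :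
    IsProbabilityMeasure (publish a T εt₁ εd εt₂ c₁ c₂ D p) := by
  have i₁ := fun n E => isProbabilityMeasure_thresholdPerturbation (M := M) (T := T) ha₀ ha₁ hεt₁
    hc₁ (n := n) E
  have i₂ := fun n E => isProbabilityMeasure_directPerturbation (M := M) hεd (n := n) E
  have i₃ := fun n E => isProbabilityMeasure_thresholdPerturbation (M := M) (T := T) ha₀ ha₁ hεt₂
    hc₂ (n := n) E
  exact Measure.isProbabilityMeasure_map (measurable_assemble p).aemeasurable

lemma closeBy_publish (ha₀ : 0 < a) (ha₁ : a < 1) (hεt₁ : 0 < εt₁) (hεd : 0 < εd)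
    (hεt₂ : 0 < εt₂) (hc₁ : 0 < c₁) (hc₂ : 0 < c₂) {D D' : Fin S → Hist M}
    (hD : ∀ i, l1Dist (D i) (D' i) ≤ 1) (p : Division S) :
    CloseBy (εt₁ + εd + εt₂) (publish a T εt₁ εd εt₂ c₁ c₂ D p)
      (publish a T εt₁ εd εt₂ c₁ c₂ D' p) := by
  have i₂ := fun n E => isProbabilityMeasure_directPerturbation (M := M) hεd (n := n) E
  have i₃ := fun n E => isProbabilityMeasure_thresholdPerturbation (M := M) (T := T) ha₀ ha₁ hεt₂
    hc₂ (n := n) E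
  rw [add_assoc]
  exact ((closeBy_thresholdPerturbation ha₀ ha₁ hεt₁ hc₁ fun _ => hD _).prod
    ((closeBy_directPerturbation hεd fun _ => hD _).prod
      (closeBy_thresholdPerturbation ha₀ ha₁ hεt₂ hc₂ fun _ => hD _))).map (measurable_assemble p)

end Publish

/-! ### Time division -/

section Division

variable {S M : ℕ} {α Δ ε : ℝ}

lemma isProbabilityMeasure_divideTime (hS : 0 < S) (D : Fin S → Hist M) :
    IsProbabilityMeasure (divideTime α Δ ε D) := by
  have : Nonempty (Division S) := ⟨⟨(⟨0, hS⟩, ⟨0, hS⟩), le_rfl⟩⟩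
  have hpos : 0 < ∑ q : Division S, Real.exp (ε * utility α D q / (2 * Δ)) :=
    Finset.sum_pos (fun _ _ => Real.exp_pos _) Finset.univ_nonempty
  constructor
  simp only [divideTime, Measure.finsetSum_apply, Measure.smul_apply, measure_univ, smul_eq_mul,
    mul_one]
  rw [← ENNReal.ofReal_sum_of_nonneg fun p _ => by positivity, ← Finset.sum_div,
    div_self hpos.ne', ENNReal.ofReal_one]

lemma DayAdj.abs_utility_sub_le (hα : 1 < α) (hΔ : utilitySensitivity S M α ≤ Δ)
    {D D' : Day S M} (h : DayAdj D D') (p : Division S) :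
    |utility α (aggregate D) p - utility α (aggregate D') p| ≤ Δ :=
  (le_csSup (utilityGaps_bddAbove S M hα) ⟨p, D, D', h, rfl⟩).trans hΔ

lemma exp_utility_le (hα : 1 < α) (hΔ : utilitySensitivity S M α ≤ Δ) (hε : 0 ≤ ε)
    {D D' : Day S M} (h : DayAdj D D') (p : Division S) :
    Real.exp (ε * utility α (aggregate D) p / (2 * Δ)) ≤
      Real.exp (ε / 2) * Real.exp (ε * utility α (aggregate D') p / (2 * Δ)) := by
  have hu := h.abs_utility_sub_le hα hΔ p
  have hΔ0 : 0 ≤ Δ := (abs_nonneg _).trans hu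
  rw [← Real.exp_add, Real.exp_le_exp]
  -- For `Δ = 0`, division by zero turns both exponents into 0, which is the uniform choice.
  rcases hΔ0.eq_or_lt with rfl | hpos
  · simp; linarith
  · have := (abs_le.1 hu).2
    rw [div_le_iff₀ (by positivity), add_mul, div_mul_cancel₀ _ (by positivity)]
    nlinarith

lemma closeBy_divideTime (hα : 1 < α) (hΔ : utilitySensitivity S M α ≤ Δ) (hε : 0 ≤ ε)
    {D D' : Day S M} (h : DayAdj D D') :
    CloseBy ε (divideTime α Δ ε (aggregate D)) (divideTime α Δ ε (aggregate D')) := by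
  refine closeBy_iff.2 fun s _ => ?_
  simp only [divideTime, Measure.finsetSum_apply, Measure.smul_apply, smul_eq_mul,
    Finset.mul_sum, ← mul_assoc]
  refine Finset.sum_le_sum fun p _ => mul_le_mul_left ?_ _
  rw [← ENNReal.ofReal_mul (Real.exp_pos _).le]
  refine ENNReal.ofReal_le_ofReal ?_
  have : Nonempty (Division S) := ⟨p⟩
  have hpos : ∀ E : Fin S → Hist M,
      0 < ∑ q : Division S, Real.exp (ε * utility α E q / (2 * Δ)) := fun E =>
    Finset.sum_pos (fun _ _ => Real.exp_pos _) Finset.univ_nonempty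
  -- The normalizing sums are compared in the opposite direction; weight and normalization each cost
  -- `ε / 2`.
  have hden : ∑ q : Division S, Real.exp (ε * utility α (aggregate D') q / (2 * Δ)) ≤
      Real.exp (ε / 2) * ∑ q : Division S, Real.exp (ε * utility α (aggregate D) q / (2 * Δ)) := by
    rw [Finset.mul_sum]
    exact Finset.sum_le_sum fun q _ => exp_utility_le hα hΔ hε h.symm q
  rw [← mul_div_assoc, div_le_div_iff₀ (hpos _) (hpos _)]
  calc _ ≤ (Real.exp (ε / 2) * Real.exp (ε * utility α (aggregate D') p / (2 * Δ))) *
        (Real.exp (ε / 2) *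
          ∑ q : Division S, Real.exp (ε * utility α (aggregate D) q / (2 * Δ))) :=
        mul_le_mul (exp_utility_le hα hΔ hε h p) hden (hpos _).le (by positivity)
    _ = _ := by
      rw [← add_halves ε, Real.exp_add, add_halves]; ring

end Division

end MobilityDP

/-! ### Privacy of the whole mechanism -/

theorem mainTheorem4 (S M H : ℕ) (hS : 0 < S)
    (α : ℝ) (hα : 1 < α) (Δ : ℝ) (hΔ : MobilityDP.utilitySensitivity S M α ≤ Δ)
    (a : ℝ) (ha₀ : 0 < a) (ha₁ : a < 1) (T : ℝ)
    (c₁ c₂ : ℕ) (hc₁ : 1 ≤ c₁) (hc₂ : 1 ≤ c₂)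
    (R₁ R₂ : MobilityDP.Regression H)
    (ε εt₁ εd εt₂ : ℝ) (hεt₁ : 0 < εt₁) (hεd : 0 < εd) (hεt₂ : 0 < εt₂)
    (hε : εt₁ + εd + εt₂ = ε) :
    MobilityDP.IsDP (MobilityDP.DatabaseAdj (S := S) (M := M) (H := H))
      (MobilityDP.dynamicHybrid hS α Δ a T εt₁ εd εt₂ c₁ c₂ R₁ R₂) ε := by
  open MobilityDP in
  have hε0 : 0 ≤ ε := by linarith
  have hdiv := fun D : Day S M => isProbabilityMeasure_divideTime (α := α) (Δ := Δ) (ε := ε) hS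
    (aggregate D)
  have hm : ∀ D : Fin S → Hist M, Measurable fun t : Fin H → Division S =>
      publish a T εt₁ εd εt₂ c₁ c₂ D (predictDivision hS R₁ R₂ t) :=
    fun D => Measurable.of_discrete
  subst hε
  refine ⟨fun B => isProbabilityMeasure_bind' (hm _) fun t =>
    isProbabilityMeasure_publish ha₀ ha₁ hεt₁ hεd hεt₂ hc₁ hc₂ _ _, ?_⟩
  intro B B' hB O _
  refine CloseBy.apply_le (e := εt₁ + εd + εt₂) ?_ O
  rcases hB with ⟨h, hh, hne, hcur⟩ | ⟨hpast, hcur⟩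
  · unfold dynamicHybrid
    rw [hcur]
    -- The loss is concentrated on the changed day `h`, so the sum over all days is a single budget.
    refine CloseBy.bind_left ((CloseBy.pi
      (e := fun k => if k = h then εt₁ + εd + εt₂ else 0) fun k => ?_).mono (by simp)) (hm _)
    split_ifs with hk
    · subst hk
      exact closeBy_divideTime hα hΔ hε0 hh
    · rw [hne k hk]
      exact CloseBy.refl le_rfl _
  · unfold dynamicHybrid
    rw [hpast]
    exact CloseBy.bind_right (hm _) (hm _) fun t =>
      closeBy_publish ha₀ ha₁ hεt₁ hεd hεt₂ hc₁ hc₂ (fun i => hcur.l1Dist_le i) _
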